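/- Let $X$ be a $T_1$ topological space. A set $F\subseteq X$ is regular closed if it is the closure of its interior, and a family $\mathcal N$ of subsets of $X$ forms a $\pi$-network in $X$ if every non-empty open set includes a non-empty member of $\mathcal N$. Let $\widehat{e}(X)$ be the smallest infinite cardinal $\kappa$ such that $X$ has no closed discrete subset of size $\kappa$, and let $\Delta(X)$ be the smallest cardinality of a non-empty open subset of $X$. For an infinite cardinal $\mu$ let $T_\mu(X)$ be the set of all points $x\in X$ such that for every $A\subseteq X$ with $|A|<\mu$ there is $B\subseteq X\setminus A$ with $|B|<\mu$ and $x\in\overline{B}$. The space $X$ is $\omega$-resolvable if it contains infinitely many pairwise disjoint dense subsets $D_0,D_1,D_2,\dots$ (for the empty space all $D_n=\emptyset$ are allowed). **Theorem.** If the regular closed subsets of $X$ form a $\pi$-network in $X$ and $T_\mu(X)$ is dense in $X$ for some regular cardinal $\mu>\widehat{e}(X)$, then $X$ is $\omega$-resolvable. In particular, every $T_3$ space $X$ (regular and $T_1$) with $\Delta(X)>\widehat{e}(X)$ is $\omega$-resolvable. -/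

import Mathlib

open Cardinal Topology

universe u

namespace Resolvability

/-- `X` is `κ`-resolvable: it contains `κ` many pairwise disjoint dense subsets. The family is
indexed by a set of size `κ`; in a non-empty space its members are automatically distinct. -/
def IsResolvable (κ : Cardinal.{u}) (X : Type u) [TopologicalSpace X] : Prop :=
  ∃ D : κ.out → Set X, (∀ i, Dense (D i)) ∧ Pairwise fun i j => Disjoint (D i) (D j)

/-- The dispersion character `Δ(X)`: the least cardinality of a non-empty open subset of `X`. -/
noncomputable def dispersionCharacter (X : Type u) [TopologicalSpace X] : Cardinal.{u} :=
  sInf {κ | ∃ G : Set X, IsOpen G ∧ G.Nonempty ∧ #G = κ}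

/-- `ê(X)`: the least infinite cardinal `κ` such that `X` has no closed discrete subset of
size `κ`. -/
noncomputable def extentHat (X : Type u) [TopologicalSpace X] : Cardinal.{u} :=
  sInf {κ | ℵ₀ ≤ κ ∧ ¬ ∃ D : Set X, IsClosed D ∧ IsDiscrete D ∧ #D = κ}

/-- A set is regular closed if it is the closure of its interior. -/
def IsRegularClosed {X : Type u} [TopologicalSpace X] (F : Set X) : Prop :=
  closure (interior F) = F

/-- A family of sets is (up to the empty set) a `π`-network: every non-empty open set includes a
non-empty member of the family. -/
def IsPiNetwork {X : Type u} [TopologicalSpace X] (N : Set (Set X)) : Prop :=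
  ∀ U : Set X, IsOpen U → U.Nonempty → ∃ F ∈ N, F.Nonempty ∧ F ⊆ U

/-- `T_μ(X)`: the points `x` such that for every set `A` of size less than `μ` there is a set `B`
of size less than `μ`, disjoint from `A`, with `x` in the closure of `B`. -/
def tPoints (μ : Cardinal.{u}) (X : Type u) [TopologicalSpace X] : Set X :=
  {x | ∀ A : Set X, #A < μ → ∃ B : Set X, B ⊆ Aᶜ ∧ #B < μ ∧ x ∈ closure B}

end Resolvability

/-! A chain splits into infinitely many disjoint pieces, each dense in its union, so it suffices to
find a chain in every non-empty open `U`. Besides the `π`-network, each half of the theorem supplies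
only this: non-empty open sets have at least `μ` points, for a regular `μ` above `extentHat X`.

Suppose `U` includes no chain. Then the iterated small limits die out on an open subset
(`exists_top_level`), so each point `x` there has a level, and a small set `A x` such that no small
set off `A x` of points of that level or higher has `x` in its closure. A well-ordered rank with
small fibres, not increasing along `A` (`exists_rank`), makes this exclude limits from higher ranks;
a second iteration, `lowerLimits`, controls limits from lower ranks. The two levels give each point
one of finitely many letters, and no point is a limit of a small set of other points with its own
letter and distinct ranks. But `extentHat X` many points always accumulate somewhere, so same-letter
points accumulate at a point with a new letter. Iterating (`exists_config_succ`) uses up more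
letters than there are. -/

namespace Resolvability

open Set

/-! ### Chains and resolvability -/

section Chains

variable {X : Type u} [TopologicalSpace X]

/-- A chain: a sequence of pairwise disjoint sets, each contained in the closure of the next one,
the first one being non-empty. -/
structure IsChainOfSets (E : ℕ → Set X) : Prop where
  disj : Pairwise fun i j => Disjoint (E i) (E j)
  nonempty : (E 0).Nonempty
  subset_closure : ∀ i, E i ⊆ closure (E (i + 1))

theorem IsChainOfSets.subset_closure_of_le {E : ℕ → Set X} (h : IsChainOfSets E) {i j : ℕ}
    (hij : i ≤ j) : E i ⊆ closure (E j) := by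
  induction j, hij using Nat.le_induction with
  | base => exact _root_.subset_closure
  | succ j _ ih => exact ih.trans (closure_minimal (h.subset_closure j) isClosed_closure)

/-- The `n`-th of infinitely many disjoint dense pieces of the union of a chain. -/
def chainPiece {X : Type u} (E : ℕ → Set X) (n : ℕ) : Set X := ⋃ k, E (Nat.pair n k)

theorem IsChainOfSets.subset_closure_chainPiece {E : ℕ → Set X} (h : IsChainOfSets E) (n : ℕ) :
    (⋃ i, E i) ⊆ closure (chainPiece E n) :=
  iUnion_subset fun i => (h.subset_closure_of_le (Nat.right_le_pair n i)).trans
    (closure_mono (subset_iUnion (fun k => E (Nat.pair n k)) i))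

theorem IsChainOfSets.disjoint_chainPiece {E : ℕ → Set X} (h : IsChainOfSets E) {m n : ℕ}
    (hmn : m ≠ n) : Disjoint (chainPiece E m) (chainPiece E n) := by
  simp only [chainPiece, disjoint_iUnion_left, disjoint_iUnion_right]
  intro i j
  refine h.disj fun he => hmn ?_
  have := congrArg Nat.unpair he
  simp only [Nat.unpair_pair, Prod.mk.injEq] at this
  exact this.1

theorem chainPiece_subset {X : Type u} (E : ℕ → Set X) (n : ℕ) : chainPiece E n ⊆ ⋃ i, E i :=
  iUnion_subset fun _ => subset_iUnion E _

/-- If every non-empty open set includes a chain, the space is `ω`-resolvable. -/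
theorem isResolvable_of_chains
    (h : ∀ U : Set X, IsOpen U → U.Nonempty → ∃ E : ℕ → Set X, IsChainOfSets E ∧ ∀ i, E i ⊆ U) :
    IsResolvable ℵ₀ X := by
  let I := {E : ℕ → Set X // IsChainOfSets E}
  let lt : I → I → Prop := WellOrderingRel
  let P : I → Set X := fun E => ⋃ G : {G : I // lt G E}, ⋃ i, G.1.1 i
  -- A chain contributes only off the closure of its predecessors. A non-empty open set is served by
  -- the first chain that meets it.
  let D : ℕ → Set X := fun n => ⋃ E : I, chainPiece E.1 n \ closure (P E)
  have hdis : ∀ m n, m ≠ n → Disjoint (D m) (D n) := by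
    intro m n hmn
    rw [Set.disjoint_left]
    intro x hx hx'
    obtain ⟨E, hE, hEP⟩ := mem_iUnion.1 hx
    obtain ⟨G, hG, hGP⟩ := mem_iUnion.1 hx'
    rcases trichotomous_of (WellOrderingRel : I → I → Prop) E G with hlt | rfl | hlt
    · exact hGP (subset_closure (mem_iUnion.2 ⟨⟨E, hlt⟩, chainPiece_subset _ _ hE⟩))
    · exact Set.disjoint_left.1 (E.2.disjoint_chainPiece hmn) hE hG
    · exact hEP (subset_closure (mem_iUnion.2 ⟨⟨G, hlt⟩, chainPiece_subset _ _ hG⟩))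
  have hdense : ∀ n, Dense (D n) := by
    intro n
    rw [dense_iff_inter_open]
    intro V hV hVne
    let S : Set I := {E | ((⋃ i, E.1 i) ∩ V).Nonempty}
    have hS : S.Nonempty := by
      obtain ⟨E, hE, hEV⟩ := h V hV hVne
      obtain ⟨x, hx⟩ := hE.nonempty
      exact ⟨⟨E, hE⟩, x, mem_iUnion.2 ⟨0, hx⟩, hEV 0 hx⟩
    have wf : WellFounded lt := IsWellFounded.wf
    obtain ⟨x, hx, hxV⟩ := wf.min_mem S hS
    obtain ⟨z, hzV, hz⟩ := mem_closure_iff.1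
      ((wf.min S hS).2.subset_closure_chainPiece n hx) V hV hxV
    refine ⟨z, hzV, mem_iUnion.2 ⟨wf.min S hS, hz, fun hzP => ?_⟩⟩
    obtain ⟨w, hwV, hw⟩ := mem_closure_iff.1 hzP V hV hzV
    obtain ⟨⟨G, hG⟩, hwG⟩ := mem_iUnion.1 hw
    exact wf.not_lt_min S (show G ∈ S from ⟨w, hwG, hwV⟩) hG
  have : #((ℵ₀ : Cardinal.{u}).out) = ℵ₀ := mk_out _
  obtain ⟨e⟩ := denumerable_iff.2 this
  let e' := Denumerable.eqv ((ℵ₀ : Cardinal.{u}).out)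
  exact ⟨fun i => D (e' i), fun i => hdense _, fun i j hij =>
    hdis _ _ fun he => hij (e'.injective he)⟩

/-- Disjoint sets that are dense in a non-empty open set give a chain in it. -/
theorem exists_chain_of_dense {U : Set X} (hU : IsOpen U) (hne : U.Nonempty) (L : ℕ → Set X)
    (hL : ∀ n, ∀ V ⊆ U, IsOpen V → V.Nonempty → (V ∩ L n).Nonempty)
    (hd : Pairwise fun i j => Disjoint (L i) (L j)) :
    ∃ E : ℕ → Set X, IsChainOfSets E ∧ ∀ i, E i ⊆ U := by
  refine ⟨fun n => U ∩ L n, ⟨fun i j hij => (hd hij).mono inter_subset_right inter_subset_right,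
    hL 0 U subset_rfl hU hne, fun i x hx => mem_closure_iff.2 fun V hV hxV => ?_⟩,
    fun i => inter_subset_left⟩
  obtain ⟨z, hz, hz'⟩ := hL (i + 1) (V ∩ U) inter_subset_right (hV.inter hU) ⟨x, hxV, hx.1⟩
  exact ⟨z, hz.1, hz.2, hz'⟩

/-- The differences of a decreasing sequence of sets are pairwise disjoint. -/
theorem pairwise_disjoint_diff_succ {α : Type*} {K : ℕ → Set α} (hK : Antitone K) :
    Pairwise fun i j => Disjoint (K i \ K (i + 1)) (K j \ K (j + 1)) := by
  have key : ∀ i j, i < j → Disjoint (K i \ K (i + 1)) (K j \ K (j + 1)) := fun i j hij =>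
    Set.disjoint_left.2 fun x hx hx' => hx.2 (hK hij hx'.1)
  intro i j hij
  rcases lt_or_gt_of_ne hij with h | h
  · exact key i j h
  · exact (key j i h).symm

end Chains

/-! ### Sets smaller than a regular cardinal -/

section Small

variable {μ : Cardinal.{u}} {X : Type u}

theorem mk_iUnion_lt_of_isRegular (hμ : μ.IsRegular) {ι : Type u} (hι : #ι < μ)
    {t : ι → Set X} (ht : ∀ i, #(t i) < μ) : #(⋃ i, t i) < μ :=
  (card_iUnion_lt_iff_forall_of_isRegular hμ hι).2 ht

theorem mk_union_lt_of_isRegular (hμ : μ.IsRegular) {s t : Set X} (hs : #s < μ) (ht : #t < μ) :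
    #(s ∪ t : Set X) < μ :=
  (mk_union_le s t).trans_lt (add_lt_of_lt hμ.aleph0_le hs ht)

theorem mk_subset_lt {s t : Set X} (h : s ⊆ t) (ht : #t < μ) : #s < μ :=
  (mk_le_mk_of_subset h).trans_lt ht

/-- A class of small sets, each of which has, off any given small set, a successor in the class
whose closure includes it, yields a chain. -/
theorem exists_chain_of_step [TopologicalSpace X] (hμ : μ.IsRegular) (Q : Set X → Prop)
    (hsmall : ∀ E, Q E → #E < μ)
    (hstep : ∀ E M : Set X, Q E → #M < μ → ∃ E', Q E' ∧ Disjoint E' M ∧ E ⊆ closure E')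
    {E₀ : Set X} (h₀ : Q E₀) (hne : E₀.Nonempty) :
    ∃ E : ℕ → Set X, IsChainOfSets E ∧ ∀ i, Q (E i) := by
  -- The second component collects all sets chosen so far, so a set disjoint from it is disjoint
  -- from every predecessor.
  let St := {p : Set X × Set X // Q p.1 ∧ #p.2 < μ ∧ p.1 ⊆ p.2}
  have hnext : ∀ p : St, ∃ q : St, Disjoint q.1.1 p.1.2 ∧ p.1.2 ⊆ q.1.2 ∧
      p.1.1 ⊆ closure q.1.1 := by
    rintro ⟨⟨E, M⟩, hQ, hM, hEM⟩
    obtain ⟨E', hQ', hd, hc⟩ := hstep E M hQ hM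
    exact ⟨⟨(E', M ∪ E'), hQ', mk_union_lt_of_isRegular hμ hM (hsmall _ hQ'),
      subset_union_right⟩, hd, subset_union_left, hc⟩
  choose f hf using hnext
  let s : ℕ → St := fun n => Nat.rec ⟨(E₀, E₀), h₀, hsmall _ h₀, subset_rfl⟩ (fun _ p => f p) n
  have hmono : Monotone fun n => (s n).1.2 := monotone_nat_of_le_succ fun n => (hf (s n)).2.1
  have key : ∀ i j, i < j → Disjoint (s j).1.1 (s i).1.1 := by
    intro i j hij
    obtain ⟨k, rfl⟩ : ∃ k, j = k + 1 := ⟨j - 1, by omega⟩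
    exact (hf (s k)).1.mono_right ((s i).2.2.2.trans (hmono (Nat.lt_succ_iff.1 hij)))
  refine ⟨fun n => (s n).1.1, ⟨fun i j hij => ?_, hne, fun i => (hf (s i)).2.2⟩,
    fun i => (s i).2.1⟩
  rcases lt_or_gt_of_ne hij with h | h
  · exact (key i j h).symm
  · exact key j i h

end Small

/-! ### Iterated small limits -/

section SmallLimits

variable {X : Type u} [TopologicalSpace X] (μ : Cardinal.{u})

/-- The points that are, off every small set, in the closure of a small subset of `S`. -/
def smallLimits (S : Set X) : Set X :=
  {x | ∀ M : Set X, #M < μ → ∃ B ⊆ S \ M, #B < μ ∧ x ∈ closure B}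

/-- The iterates of `smallLimits`, starting with the whole space. -/
def iterLimits : ℕ → Set X
  | 0 => univ
  | n + 1 => smallLimits μ (iterLimits n)

variable {μ}

theorem smallLimits_mono {S T : Set X} (h : S ⊆ T) : smallLimits μ S ⊆ smallLimits μ T :=
  fun _ hx M hM => let ⟨B, hB, hB'⟩ := hx M hM
    ⟨B, hB.trans (sdiff_subset_sdiff_left h), hB'⟩

theorem antitone_iterLimits : Antitone (iterLimits (X := X) μ) := by
  refine antitone_nat_of_succ_le fun n => ?_
  induction n with
  | zero => exact subset_univ _
  | succ n ih => exact smallLimits_mono ih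

theorem mem_smallLimits_inter {S V : Set X} {x : X} (hV : IsOpen V) (hxV : x ∈ V)
    (hx : x ∈ smallLimits μ S) : x ∈ smallLimits μ (S ∩ V) := by
  intro M hM
  obtain ⟨B, hB, hBμ, hxB⟩ := hx M hM
  refine ⟨B ∩ V, fun y hy => ⟨⟨(hB hy.1).1, hy.2⟩, (hB hy.1).2⟩,
    mk_subset_lt inter_subset_left hBμ, ?_⟩
  rw [inter_comm]
  exact hV.inter_closure ⟨hxV, hxB⟩

/-- A small set of small limits of `S` is in the closure of one small subset of `S`. -/
theorem exists_small_subset_closure (hμ : μ.IsRegular) {S E : Set X} (hE : #E < μ)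
    (hES : E ⊆ smallLimits μ S) {M : Set X} (hM : #M < μ) :
    ∃ B ⊆ S \ M, #B < μ ∧ E ⊆ closure B := by
  choose B hB hBμ hxB using fun x : E => hES x.2 M hM
  exact ⟨⋃ x, B x, iUnion_subset hB, mk_iUnion_lt_of_isRegular hμ hE hBμ,
    fun x hx => closure_mono (subset_iUnion B ⟨x, hx⟩) (hxB ⟨x, hx⟩)⟩

theorem exists_chain_of_subset_smallLimits (hμ : μ.IsRegular) {S : Set X} (hne : S.Nonempty)
    (hS : S ⊆ smallLimits μ S) : ∃ E : ℕ → Set X, IsChainOfSets E ∧ ∀ i, E i ⊆ S := by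
  obtain ⟨x, hx⟩ := hne
  obtain ⟨E, hE, hQ⟩ := exists_chain_of_step hμ (fun E => E ⊆ S ∧ #E < μ) (fun E h => h.2)
    (fun E M hE hM => by
      obtain ⟨B, hB, hBμ, hEB⟩ := exists_small_subset_closure hμ hE.2 (hE.1.trans hS) hM
      exact ⟨B, ⟨hB.trans sdiff_subset, hBμ⟩,
        Set.disjoint_left.2 fun y hy => (hB hy).2, hEB⟩)
    (E₀ := {x}) ⟨singleton_subset_iff.2 hx, by
      rw [mk_singleton]; exact one_lt_aleph0.trans_le hμ.aleph0_le⟩ (singleton_nonempty x)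
  exact ⟨E, hE, fun i => (hQ i).1⟩

/-- If a small set of small limits of `S` is dense in the open set `V`, then `V` includes a
chain. -/
theorem exists_chain_of_small_dense (hμ : μ.IsRegular) {S E V : Set X} (hV : IsOpen V)
    (hEμ : #E < μ) (hE : E ⊆ smallLimits μ S) (hne : E.Nonempty) (hEV : E ⊆ V)
    (hd : V ⊆ closure E) : ∃ E : ℕ → Set X, IsChainOfSets E ∧ ∀ i, E i ⊆ V := by
  -- A set whose closure includes the original `E` is dense in `V`, hence can follow every `G ⊆ V`;
  -- the points of `G` need not be small limits.
  obtain ⟨E, hE, hQ⟩ := exists_chain_of_step hμ (fun E => E ⊆ V ∧ #E < μ) (fun E h => h.2)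
    (fun G M hG hM => by
      obtain ⟨B, hB, hBμ, hEB⟩ := exists_small_subset_closure hμ (S := S ∩ V) hEμ
        (fun x hx => mem_smallLimits_inter hV (hEV hx) (hE hx)) hM
      exact ⟨B, ⟨fun y hy => (hB hy).1.2, hBμ⟩, Set.disjoint_left.2 fun y hy => (hB hy).2,
        hG.1.trans (hd.trans (closure_minimal hEB isClosed_closure))⟩)
    (E₀ := E) ⟨hEV, hEμ⟩ hne
  exact ⟨E, hE, fun i => (hQ i).1⟩

/-- In an open set without chains whose non-empty open subsets are big there is an open set on
which the iterated small limits reach a last level, whose traces are big. -/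
theorem exists_top_level (hμ : μ.IsRegular) {U : Set X} (hU : IsOpen U) (hUne : U.Nonempty)
    (hch : ¬ ∃ E : ℕ → Set X, IsChainOfSets E ∧ ∀ i, E i ⊆ U)
    (hbig : ∀ V : Set X, IsOpen V → V.Nonempty → μ ≤ #V) :
    ∃ O ⊆ U, IsOpen O ∧ O.Nonempty ∧ ∃ N, O ∩ iterLimits μ (N + 1) = ∅ ∧
      ∀ V ⊆ O, IsOpen V → V.Nonempty → μ ≤ #(V ∩ iterLimits μ N : Set X) := by
  -- Were the difference to miss `V`, the trace of level `n` on `V` would lie in its own small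
  -- limits and give a chain.
  have hdiff : ∀ n, ∀ V ⊆ U, IsOpen V → (V ∩ iterLimits μ n).Nonempty →
      (V ∩ (iterLimits μ n \ iterLimits μ (n + 1))).Nonempty := by
    intro n V hVU hV hne
    by_contra hemp
    rw [not_nonempty_iff_eq_empty] at hemp
    obtain ⟨E, hE, hES⟩ := exists_chain_of_subset_smallLimits hμ
      (S := iterLimits μ n ∩ V) (by rwa [inter_comm]) (fun x hx =>
        mem_smallLimits_inter hV hx.2 (by
          by_contra hx'
          exact hemp.subset ⟨hx.2, hx.1, hx'⟩))
    exact hch ⟨E, hE, fun i => (hES i).trans (inter_subset_right.trans hVU)⟩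
  have hex : ∃ n, ∃ O ⊆ U, IsOpen O ∧ O.Nonempty ∧ O ∩ iterLimits μ n = ∅ := by
    by_contra! hno
    refine hch (exists_chain_of_dense hU hUne (fun n => iterLimits μ n \ iterLimits μ (n + 1))
      (fun n V hVU hV hne => hdiff n V hVU hV (hno n V hVU hV hne))
      (pairwise_disjoint_diff_succ antitone_iterLimits))
  classical
  obtain ⟨O, hOU, hO, hOne, hemp⟩ := Nat.find_spec hex
  have hmin : ∀ m < Nat.find hex, ∀ V ⊆ O, IsOpen V → V.Nonempty →
      (V ∩ iterLimits μ m).Nonempty := by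
    intro m hm V hVO hV hVne
    by_contra hV'
    exact Nat.find_min hex hm ⟨V, hVO.trans hOU, hV, hVne, not_nonempty_iff_eq_empty.1 hV'⟩
  obtain ⟨N, hN⟩ : ∃ N, Nat.find hex = N + 1 := by
    refine Nat.exists_eq_succ_of_ne_zero fun h0 => ?_
    rw [h0] at hemp
    simp only [iterLimits, inter_univ] at hemp
    exact hOne.ne_empty hemp
  rw [hN] at hemp hmin
  refine ⟨O, hOU, hO, hOne, N, hemp, fun V hVO hV hVne => ?_⟩
  -- Level 0 is the whole space. A higher trace with fewer than `μ` points would, by minimality of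
  -- `N + 1`, be a small dense set of small limits.
  cases N with
  | zero => simpa [iterLimits] using hbig V hV hVne
  | succ N =>
    by_contra hlt
    rw [not_le] at hlt
    obtain ⟨E, hE, hEV⟩ := exists_chain_of_small_dense hμ (S := iterLimits μ N) hV hlt
      (fun x hx => hx.2) (hmin _ (Nat.lt_succ_self _) V hVO hV hVne) inter_subset_left
      (fun x hx => mem_closure_iff.2 fun W hW hxW => by
        obtain ⟨z, hz, hz'⟩ := hmin _ (Nat.lt_succ_self _) (W ∩ V)
          (inter_subset_right.trans hVO) (hW.inter hV) ⟨x, hxW, hx⟩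
        exact ⟨z, hz.1, hz.2, hz'⟩)
    exact hch ⟨E, hE, fun i => (hEV i).trans (hVO.trans hOU)⟩

end SmallLimits

/-! ### Ranks for set mappings with small values -/

section Rank

variable {μ : Cardinal.{u}} {X : Type u}

/-- Close `{z}` under `A` in `ω` steps; regularity and uncountability of `μ` keep the union small.
-/
theorem exists_small_closed_superset (hμ : μ.IsRegular) (hμ' : ℵ₀ < μ) (A : X → Set X)
    (hA : ∀ x, #(A x) < μ) (z : X) :
    ∃ C : Set X, z ∈ C ∧ #C < μ ∧ ∀ x ∈ C, A x ⊆ C := by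
  let C : ℕ → Set X := fun n => Nat.rec {z} (fun _ S => ⋃ x : S, A x) n
  have hC : ∀ n, #(↥(C n)) < μ := by
    intro n
    induction n with
    | zero =>
      change #({z} : Set X) < μ
      rw [mk_singleton]
      exact one_lt_aleph0.trans hμ'
    | succ n ih => exact mk_iUnion_lt_of_isRegular hμ ih fun x => hA x.1
  refine ⟨⋃ n : ULift.{u} ℕ, C n.down, mem_iUnion.2 ⟨⟨0⟩, rfl⟩,
    mk_iUnion_lt_of_isRegular hμ (by simpa using hμ') fun n => hC _, fun x hx y hy => ?_⟩
  obtain ⟨⟨n⟩, hn⟩ := mem_iUnion.1 hx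
  exact mem_iUnion.2 ⟨⟨n + 1⟩, mem_iUnion.2 ⟨⟨x, hn⟩, hy⟩⟩

/-- A set mapping with small values admits a well-ordered rank with small fibres that does not
increase along the mapping. -/
theorem exists_rank (hμ : μ.IsRegular) (hμ' : ℵ₀ < μ) (A : X → Set X) (hA : ∀ x, #(A x) < μ) :
    ∃ (R : Type u) (_ : LinearOrder R) (_ : WellFoundedLT R) (r : X → R),
      (∀ v, #(r ⁻¹' {v}) < μ) ∧ ∀ x, ∀ y ∈ A x, r y ≤ r x := by
  classical
  choose C hzC hCμ hCA using exists_small_closed_superset hμ hμ' A hA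
  let _ : LinearOrder X := linearOrderOfSTO (WellOrderingRel : X → X → Prop)
  have wf : WellFoundedLT X := ⟨(IsWellFounded.wf : WellFounded (WellOrderingRel : X → X → Prop))⟩
  have hne : ∀ x, {z | x ∈ C z}.Nonempty := fun x => ⟨x, hzC x⟩
  -- The fibre over `z` lies in `C z`, and closedness of `C (r x)` under `A` bounds the rank on `A
  -- x` by `r x`.
  let r : X → X := fun x => wf.wf.min {z | x ∈ C z} (hne x)
  have hr : ∀ x, x ∈ C (r x) := fun x => wf.wf.min_mem _ (hne x)
  refine ⟨X, inferInstance, wf, r, fun v => mk_subset_lt ?_ (hCμ v), fun x y hy => ?_⟩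
  · rintro x rfl
    exact hr x
  · exact not_lt.1 (wf.wf.not_lt_min {z | y ∈ C z} (hCA _ _ (hr x) hy))

/-- Objects with small supports that can be found off every small set can be chosen with pairwise
disjoint supports. -/
theorem exists_disjoint_family (hμ : μ.IsRegular) {α : Type*} (S : α → Set X)
    (hS : ∀ a, #(S a) < μ) (h : ∀ M : Set X, #M < μ → ∃ a, Disjoint (S a) M)
    {I : Type u} (hI : #I < μ) :
    ∃ f : I → α, Pairwise fun i j => Disjoint (S (f i)) (S (f j)) := by
  choose g hg using h
  have wf : WellFounded (WellOrderingRel : I → I → Prop) := IsWellFounded.wf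
  have hlt : ∀ (i : I) (F : ∀ j, WellOrderingRel j i → α),
      #(⋃ j : {j // WellOrderingRel j i}, S (F j.1 j.2) : Set X) < μ := fun i F =>
    mk_iUnion_lt_of_isRegular hμ ((mk_subtype_le _).trans_lt hI) fun j => hS _
  let f : I → α := wf.fix fun i F => g _ (hlt i F)
  have hf : ∀ i, f i = g _ (hlt i fun j _ => f j) := fun i => wf.fix_eq _ i
  have key : ∀ i j, WellOrderingRel j i → Disjoint (S (f i)) (S (f j)) := by
    intro i j hji
    rw [hf i]
    exact (hg _ (hlt i fun j _ => f j)).mono_right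
      (subset_iUnion (fun j : {j // WellOrderingRel j i} => S (f j.1)) ⟨j, hji⟩)
  refine ⟨f, fun i j hij => ?_⟩
  rcases trichotomous_of (WellOrderingRel : I → I → Prop) i j with h | h | h
  · exact (key j i h).symm
  · exact absurd h hij
  · exact key i j h

end Rank

/-! ### Configurations and their accumulation points -/

section Configurations

variable {X : Type u} [TopologicalSpace X]

theorem mem_closure_of_subset_union_subsingleton [T1Space X] {C Z T : Set X} {x : X}
    (hx : x ∈ closure C) (hC : C ⊆ Z ∪ T) (hT : T.Subsingleton) (hxT : x ∉ T) :
    x ∈ closure Z := by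
  have := closure_mono hC hx
  rw [closure_union, hT.isClosed.closure_eq] at this
  exact this.resolve_right hxT

variable {ι R : Type u} (μ : Cardinal.{u}) (O H : Set X) (l : X → ι) (r : X → R)

/-- A point `y` off `M`, whose letter is not in `s`, that is for each letter of `s` in the closure
of a small set of points off `M` with that letter and with distinct ranks, some point or set
involved being in `H`. -/
structure IsConfig (s : Finset ι) (M : Set X) (y : X) (B : ι → Set X) : Prop where
  notMem : y ∉ M
  letter_notMem : l y ∉ s
  subset : ∀ i, B i ⊆ O
  disj : ∀ i, Disjoint (B i) M
  letter_eq : ∀ i, ∀ b ∈ B i, l b = i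
  injOn : ∀ i, InjOn r (B i)
  small : ∀ i, #(B i) < μ
  mem_closure : ∀ i ∈ s, y ∈ closure (B i)
  bottom : ∃ o : Option ι, o.elim (y ∈ H) fun i => i ∈ s ∧ B i ⊆ H

variable {μ O H l r}

theorem IsConfig.anti {s : Finset ι} {M N : Set X} {y : X} {B : ι → Set X}
    (h : IsConfig μ O H l r s M y B) (hN : N ⊆ M) : IsConfig μ O H l r s N y B :=
  { h with
    notMem := fun hy => h.notMem (hN hy)
    disj := fun i => (h.disj i).mono_right hN }

/-- Inside the interior of a regular closed `F ⊆ V`, take `κ` configurations whose supports have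
disjoint sets of ranks, and thin them out to constant letters. Their points `y` accumulate at some
`x`, which stays in `F ⊆ V`. By `hsep` the letter of `x` is new, so the points `y` become the set
for one additional letter. -/
theorem exists_config_succ [T1Space X] [Finite ι] (hμ : μ.IsRegular) {κ : Cardinal.{u}}
    (hκ : ℵ₀ ≤ κ) (hκμ : κ < μ)
    (hacc : ∀ D : Set X, #D = κ → ∃ x, x ∈ closure (D \ {x}))
    (hpi : IsPiNetwork {F : Set X | IsRegularClosed F}) {A : X → Set X} (hA : ∀ x, #(A x) < μ)
    (hr : ∀ v, #(r ⁻¹' {v}) < μ)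
    (hsep : ∀ x ∈ O, ∀ B ⊆ O, #B < μ → InjOn r B → (∀ b ∈ B, l b = l x) → x ∉ closure (B \ {x}))
    (hbot : ∀ x ∈ O, ∀ B ⊆ O, B ⊆ H → #B < μ → Disjoint B (A x) → x ∉ closure B) {c : ℕ}
    (hc : ∀ V ⊆ O, IsOpen V → V.Nonempty → ∀ M : Set X, #M < μ →
      ∃ s : Finset ι, s.card = c ∧ ∃ y ∈ V, ∃ B, IsConfig μ O H l r s M y B)
    {V : Set X} (hVO : V ⊆ O) (hV : IsOpen V) (hVne : V.Nonempty) {M : Set X} (hM : #M < μ) :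
    ∃ s : Finset ι, s.card = c + 1 ∧ ∃ y ∈ V, ∃ B, IsConfig μ O H l r s M y B := by
  classical
  obtain ⟨F, hF, hFne, hFV⟩ := hpi V hV hVne
  change closure (interior F) = F at hF
  have hWne : (interior F).Nonempty := by
    rw [← closure_nonempty_iff, hF]
    exact hFne
  have hWO : interior F ⊆ O := interior_subset.trans (hFV.trans hVO)
  -- Including `A x` for `x ∈ M` keeps the new limit off `M`: by `hbot`, no point of `M` in `O` is a
  -- limit of a bottom set that avoids `M'`.
  let M' : Set X := M ∪ ⋃ x : M, A x
  have hM' : #M' < μ := mk_union_lt_of_isRegular hμ hM (mk_iUnion_lt_of_isRegular hμ hM fun x => hA x)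
  have hιμ : #ι < μ := (lt_aleph0_of_finite ι).trans_le hμ.aleph0_le
  let α := {a : X × (ι → Set X) × Finset ι //
    a.2.2.card = c ∧ a.1 ∈ interior F ∧ IsConfig μ O H l r a.2.2 M' a.1 a.2.1}
  let S : α → Set R := fun a => r '' ({a.1.1} ∪ ⋃ i, a.1.2.1 i)
  have hS : ∀ a, #(S a) < μ := fun a => mk_image_le.trans_lt (mk_union_lt_of_isRegular hμ
    (by rw [mk_singleton]; exact one_lt_aleph0.trans_le hμ.aleph0_le)
    (mk_iUnion_lt_of_isRegular hμ hιμ a.2.2.2.small))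
  have hex : ∀ N : Set R, #N < μ → ∃ a, Disjoint (S a) N := by
    intro N hN
    have hpre : #(r ⁻¹' N) < μ := by
      refine mk_subset_lt (t := ⋃ v : N, r ⁻¹' {v.1}) (fun x hx => ?_)
        (mk_iUnion_lt_of_isRegular hμ hN fun v => hr v)
      exact mem_iUnion.2 ⟨⟨r x, hx⟩, rfl⟩
    obtain ⟨s, hs, y, hy, B, hB⟩ := hc _ hWO isOpen_interior hWne (M' ∪ r ⁻¹' N)
      (mk_union_lt_of_isRegular hμ hM' hpre)
    refine ⟨⟨(y, B, s), hs, hy, hB.anti subset_union_left⟩, Set.disjoint_left.2 ?_⟩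
    rintro _ ⟨z, hz, rfl⟩ hzN
    rcases hz with rfl | hz
    · exact hB.notMem (Or.inr hzN)
    · obtain ⟨i, hi⟩ := mem_iUnion.1 hz
      exact Set.disjoint_left.1 (hB.disj i) hi (Or.inr hzN)
  obtain ⟨f, hf⟩ := exists_disjoint_family hμ S hS hex (I := κ.out) (by rwa [mk_out])
  let y : κ.out → X := fun j => (f j).1.1
  let B : κ.out → ι → Set X := fun j => (f j).1.2.1
  let s : κ.out → Finset ι := fun j => (f j).1.2.2
  have hcard : ∀ j, (s j).card = c := fun j => (f j).2.1
  have hyF : ∀ j, y j ∈ interior F := fun j => (f j).2.2.1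
  have hcfg : ∀ j, IsConfig μ O H l r (s j) M' (y j) (B j) := fun j => (f j).2.2.2
  have hyS : ∀ j, r (y j) ∈ S (f j) := fun j => ⟨_, Or.inl rfl, rfl⟩
  have hBS : ∀ j i, ∀ b ∈ B j i, r b ∈ S (f j) := fun j i b hb =>
    ⟨b, Or.inr (mem_iUnion.2 ⟨i, hb⟩), rfl⟩
  have hSeq : ∀ {v : R} {j j'}, v ∈ S (f j) → v ∈ S (f j') → j = j' := by
    intro v j j' h h'
    by_contra hne
    exact Set.disjoint_left.1 (hf hne) h h'
  have hyinj : Function.Injective y := fun j j' h => hSeq (hyS j) (by rw [h]; exact hyS j')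
  choose o ho using fun j => (hcfg j).bottom
  obtain ⟨⟨s₀, k, o₀⟩, hJ⟩ := infinite_pigeonhole
    (fun j : κ.out => ((s j, l (y j), o j) : Finset ι × ι × Option ι)) (by rwa [mk_out])
    (by
      rw [mk_out]
      refine (lt_aleph0_of_finite _).trans_le ?_
      exact (isRegular_cof (isSuccLimit_ord hκ)).aleph0_le)
  rw [mk_out] at hJ
  set J : Set κ.out := (fun j : κ.out => ((s j, l (y j), o j) : Finset ι × ι × Option ι)) ⁻¹'
    {(s₀, k, o₀)} with hJdef
  have hJs : ∀ j ∈ J, s j = s₀ ∧ l (y j) = k ∧ o j = o₀ := fun j hj => by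
    simpa [hJdef] using hj
  obtain ⟨x, hx⟩ := hacc (y '' J) (by rw [mk_image_eq hyinj, hJ])
  have hxF : x ∈ F := by
    rw [← hF]
    refine closure_mono ?_ hx
    rintro _ ⟨⟨j, -, rfl⟩, -⟩
    exact hyF j
  have hxO : x ∈ O := hVO (hFV hxF)
  -- Disjointness of the supports means that at most one index is dropped, so `x` remains a limit by
  -- `T₁`, now of points of other ranks.
  let J' : Set κ.out := {j ∈ J | r x ∉ S (f j)}
  have hJ'μ : #J' < μ := (mk_set_le _).trans_lt (by rwa [mk_out])
  have hxZ : x ∈ closure (y '' J') := by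
    refine mem_closure_of_subset_union_subsingleton (T := (y '' {j ∈ J | r x ∈ S (f j)}) \ {x})
      hx ?_ ?_ fun h => h.2 rfl
    · rintro _ ⟨⟨j, hj, rfl⟩, hne⟩
      by_cases hjx : r x ∈ S (f j)
      · exact Or.inr ⟨⟨j, ⟨hj, hjx⟩, rfl⟩, hne⟩
      · exact Or.inl ⟨j, ⟨hj, hjx⟩, rfl⟩
    · rintro _ ⟨⟨j, hj, rfl⟩, -⟩ _ ⟨⟨j', hj', rfl⟩, -⟩
      rw [hSeq hj.2 hj'.2]
  let Z : Set X := y '' J'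
  have hZO : Z ⊆ O := by
    rintro _ ⟨j, -, rfl⟩
    exact hWO (hyF j)
  have hZμ : #Z < μ := mk_image_le.trans_lt hJ'μ
  have hZM : Disjoint Z M' := by
    rw [Set.disjoint_left]
    rintro _ ⟨j, -, rfl⟩
    exact (hcfg j).notMem
  have hZl : ∀ b ∈ Z, l b = k := by
    rintro _ ⟨j, hj, rfl⟩
    exact (hJs j hj.1).2.1
  have hZr : InjOn r Z := by
    rintro _ ⟨j, hj, rfl⟩ _ ⟨j', hj', rfl⟩ h
    rw [hSeq (hyS j) (by rw [h]; exact hyS j')]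
  have hxnZ : x ∉ Z := by
    rintro ⟨j, hj, rfl⟩
    exact hj.2 (hyS j)
  let B' : ι → Set X := fun i => ⋃ j : J', B j i
  have hB'O : ∀ i, B' i ⊆ O := fun i => iUnion_subset fun j => (hcfg j).subset i
  have hB'μ : ∀ i, #(B' i) < μ := fun i =>
    mk_iUnion_lt_of_isRegular hμ hJ'μ fun j => (hcfg j).small i
  have hB'M : ∀ i, Disjoint (B' i) M' := fun i => disjoint_iUnion_left.2 fun j => (hcfg j).disj i
  have hB'l : ∀ i, ∀ b ∈ B' i, l b = i := by
    intro i b hb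
    obtain ⟨j, hj⟩ := mem_iUnion.1 hb
    exact (hcfg j).letter_eq i b hj
  have hB'r : ∀ i, InjOn r (B' i) := by
    intro i b hb b' hb' h
    obtain ⟨⟨j, hj'⟩, hj⟩ := mem_iUnion.1 hb
    obtain ⟨⟨j₂, hj₂'⟩, hj₂⟩ := mem_iUnion.1 hb'
    obtain rfl := hSeq (hBS j i b hj) (by rw [h]; exact hBS j₂ i b' hj₂)
    exact (hcfg j).injOn i hj hj₂ h
  have hxnB' : ∀ i, x ∉ B' i := by
    intro i hi
    obtain ⟨⟨j, hj⟩, hj'⟩ := mem_iUnion.1 hi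
    exact hj.2 (hBS j i x hj')
  have hxB' : ∀ i ∈ s₀, x ∈ closure (B' i) := by
    intro i hi
    refine closure_minimal ?_ isClosed_closure hxZ
    rintro _ ⟨j, hj, rfl⟩
    refine closure_mono (subset_iUnion (fun j : J' => B j i) ⟨j, hj⟩)
      ((hcfg j).mem_closure i ?_)
    rwa [(hJs j hj.1).1]
  have hks : k ∉ s₀ ∧ s₀.card = c := by
    have hJ'ne : J'.Nonempty := by
      by_contra hemp
      rw [not_nonempty_iff_eq_empty] at hemp
      simp [hemp] at hxZ
    obtain ⟨j, hj⟩ := hJ'ne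
    obtain ⟨h1, h2, -⟩ := hJs j hj.1
    rw [← h1, ← h2]
    exact ⟨(hcfg j).letter_notMem, hcard j⟩
  have hlxk : l x ≠ k := fun h => hsep x hxO Z hZO hZμ hZr (fun b hb => (hZl b hb).trans h.symm)
    (by rwa [sdiff_singleton_eq_self hxnZ])
  have hlxs : l x ∉ s₀ := fun h => hsep x hxO (B' (l x)) (hB'O _) (hB'μ _) (hB'r _) (hB'l _)
    (by rw [sdiff_singleton_eq_self (hxnB' _)]; exact hxB' _ h)
  let B'' : ι → Set X := fun i => if i = k then Z else B' i
  have hB''k : B'' k = Z := if_pos rfl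
  have hB'' : ∀ i, i ≠ k → B'' i = B' i := fun i hi => if_neg hi
  have hbottom : ∃ i ∈ insert k s₀, B'' i ⊆ H := by
    cases o₀ with
    | none =>
      refine ⟨k, Finset.mem_insert_self _ _, ?_⟩
      rw [hB''k]
      rintro _ ⟨j, hj, rfl⟩
      have := ho j
      rw [(hJs j hj.1).2.2] at this
      exact this
    | some i =>
      have key : ∀ j ∈ J', i ∈ s₀ ∧ B j i ⊆ H := by
        intro j hj
        have := ho j
        rw [(hJs j hj.1).2.2, (hJs j hj.1).1] at this
        exact this
      by_cases hik : i ∈ s₀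
      · refine ⟨i, Finset.mem_insert_of_mem hik, ?_⟩
        rw [hB'' i fun h => hks.1 (h ▸ hik)]
        exact iUnion_subset fun j => (key j j.2).2
      · refine ⟨k, Finset.mem_insert_self _ _, ?_⟩
        rw [hB''k]
        rintro _ ⟨j, hj, rfl⟩
        exact absurd (key j hj).1 hik
  have all : ∀ {p : ι → Set X → Prop}, p k Z → (∀ i, p i (B' i)) → ∀ i, p i (B'' i) := by
    intro p hk h i
    by_cases hi : i = k
    · rw [hi, hB''k]
      exact hk
    · rw [hB'' i hi]
      exact h i
  have hsub'' : ∀ i, B'' i ⊆ O := all (p := fun _ S => S ⊆ O) hZO hB'O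
  have hdis'' : ∀ i, Disjoint (B'' i) M' := all (p := fun _ S => Disjoint S M') hZM hB'M
  have hsm'' : ∀ i, #(B'' i) < μ := all (p := fun _ S => #S < μ) hZμ hB'μ
  have hcl'' : ∀ i ∈ insert k s₀, x ∈ closure (B'' i) := by
    intro i hi
    by_cases hik : i = k
    · rw [hik, hB''k]
      exact hxZ
    · rw [hB'' i hik]
      exact hxB' i ((Finset.mem_insert.1 hi).resolve_left hik)
  refine ⟨insert k s₀, by rw [Finset.card_insert_of_notMem hks.1, hks.2], x, hFV hxF, B'', ?_⟩
  obtain ⟨i, hi, hiH⟩ := hbottom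
  refine ⟨fun hxM => ?_, by simp [hlxk, hlxs], hsub'',
    fun i => (hdis'' i).mono_right subset_union_left, all (p := fun i S => ∀ b ∈ S, l b = i) hZl hB'l,
    all (p := fun _ S => InjOn r S) hZr hB'r, hsm'', hcl'', ⟨some i, hi, hiH⟩⟩
  exact hbot x hxO (B'' i) (hsub'' i) hiH (hsm'' i)
    ((hdis'' i).mono_right ((subset_iUnion (fun x : M => A x) ⟨x, hxM⟩).trans subset_union_right))
    (hcl'' i hi)

end Configurations

/-! ### Letters and the final contradiction -/

section Main

variable {X : Type u} [TopologicalSpace X]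

theorem exists_mem_closure_sdiff_of_extentHat :
    ℵ₀ ≤ extentHat X ∧
      ∀ D : Set X, #D = extentHat X → ∃ x, x ∈ closure (D \ {x}) := by
  have hne : {κ | ℵ₀ ≤ κ ∧ ¬ ∃ D : Set X, IsClosed D ∧ IsDiscrete D ∧ #D = κ}.Nonempty := by
    refine ⟨max ℵ₀ (Order.succ #X), le_max_left _ _, ?_⟩
    rintro ⟨D, -, -, hD⟩
    exact ((Order.lt_succ #X).trans_le (le_max_right _ _)).not_ge (hD ▸ mk_set_le D)
  obtain ⟨h1, h2⟩ := csInf_mem hne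
  refine ⟨h1, fun D hD => ?_⟩
  by_contra! hno
  have hcd : IsClosed D ∧ IsDiscrete D := by
    rw [isClosed_and_discrete_iff]
    intro x
    have := hno x
    rw [mem_closure_iff_nhdsWithin_neBot, Filter.not_neBot] at this
    rw [disjoint_iff, nhdsWithin, inf_assoc, Filter.inf_principal, inter_comm,
      ← sdiff_eq]
    exact this
  exact h2 ⟨D, hcd.1, hcd.2, hD⟩

/-- Iterated sets of points that are limits of points of lower rank with the same colour. -/
def lowerLimits {R : Type*} [LT R] (t : X → ℕ) (r : X → R) : ℕ → Set X
  | 0 => univ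
  | m + 1 => {x ∈ lowerLimits t r m |
      x ∈ closure {y ∈ lowerLimits t r m | t y = t x ∧ r y < r x}}

theorem antitone_lowerLimits {R : Type*} [LT R] (t : X → ℕ) (r : X → R) :
    Antitone (lowerLimits t r) :=
  antitone_nat_of_succ_le fun _ _ hx => hx.1

/-- A point of least rank in the trace on `V` cannot be a limit of lower-ranked points of that
level. -/
theorem inter_lowerLimits_diff_nonempty {R : Type*} [LinearOrder R] [WellFoundedLT R] (t : X → ℕ)
    (r : X → R) (m : ℕ) {V : Set X} (hV : IsOpen V) (hne : (V ∩ lowerLimits t r m).Nonempty) :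
    (V ∩ (lowerLimits t r m \ lowerLimits t r (m + 1))).Nonempty := by
  obtain ⟨x, hx, hmin⟩ := WellFounded.has_min (InvImage.wf r wellFounded_lt) _ hne
  refine ⟨x, hx.1, hx.2, fun hx' => ?_⟩
  obtain ⟨z, hzV, hz⟩ := mem_closure_iff.1 hx'.2 V hV hx.1
  exact hmin z ⟨hzV, hz.1⟩ hz.2.2

/-- The level of `x` in an antitone sequence of sets starting with the whole space, up to `N`. -/
theorem exists_level {α : Type*} {K : ℕ → Set α} (h0 : K 0 = Set.univ) {N : ℕ} {x : α}
    (hN : x ∉ K N) : ∃ n < N, x ∈ K n ∧ x ∉ K (n + 1) := by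
  induction N with
  | zero => exact absurd (h0 ▸ Set.mem_univ x) hN
  | succ N ih =>
    by_cases hx : x ∈ K N
    · exact ⟨N, Nat.lt_succ_self _, hx, hN⟩
    · obtain ⟨n, hn, h⟩ := ih hx
      exact ⟨n, hn.trans (Nat.lt_succ_self _), h⟩

theorem exists_chain [T1Space X] (hpi : IsPiNetwork {F : Set X | IsRegularClosed F})
    {μ : Cardinal.{u}} (hμ : μ.IsRegular) (hext : extentHat X < μ)
    (hbig : ∀ V : Set X, IsOpen V → V.Nonempty → μ ≤ #V)
    {U : Set X} (hU : IsOpen U) (hUne : U.Nonempty) :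
    ∃ E : ℕ → Set X, IsChainOfSets E ∧ ∀ i, E i ⊆ U := by
  classical
  by_contra hch
  obtain ⟨hκ, hacc⟩ := exists_mem_closure_sdiff_of_extentHat (X := X)
  obtain ⟨O₁, hO₁U, hO₁, hO₁ne, N, hemp, hH⟩ := exists_top_level hμ hU hUne hch hbig
  have hlev : ∀ x ∈ O₁, ∃ n < N + 1, x ∈ iterLimits μ n ∧ x ∉ iterLimits μ (n + 1) :=
    fun x hx => exists_level (K := iterLimits μ) rfl fun hx' => hemp.subset ⟨hx, hx'⟩
  choose! t htN ht ht' using hlev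
  have hA : ∀ x, ∃ A : Set X, #A < μ ∧
      (x ∈ O₁ → ∀ B ⊆ iterLimits μ (t x), #B < μ → Disjoint B A → x ∉ closure B) := by
    intro x
    by_cases hx : x ∈ O₁
    · have := ht' x hx
      simp only [iterLimits, smallLimits, mem_ofPred_eq, not_forall, not_exists, not_and] at this
      obtain ⟨A, hA, h⟩ := this
      exact ⟨A, hA, fun _ B hB hBμ hBA => h B
        (fun b hb => ⟨hB hb, Set.disjoint_left.1 hBA hb⟩) hBμ⟩
    · refine ⟨∅, ?_, fun h => absurd h hx⟩
      rw [mk_eq_zero]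
      exact hμ.pos
  choose A hAμ hA using hA
  obtain ⟨R, _, _, r, hr, hrA⟩ := exists_rank hμ (hκ.trans_lt hext) A hAμ
  obtain ⟨m, O, hOO₁, hO, hOne, hOm⟩ : ∃ m, ∃ O ⊆ O₁, IsOpen O ∧ O.Nonempty ∧
      O ∩ lowerLimits t r m = ∅ := by
    by_contra! hno
    obtain ⟨E, hE, hEO⟩ := exists_chain_of_dense hO₁ hO₁ne
      (fun n => lowerLimits t r n \ lowerLimits t r (n + 1))
      (fun n V hVO hV hne => inter_lowerLimits_diff_nonempty t r n hV (hno n V hVO hV hne))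
      (pairwise_disjoint_diff_succ (antitone_lowerLimits t r))
    exact hch ⟨E, hE, fun i => (hEO i).trans hO₁U⟩
  have hlev : ∀ x ∈ O, ∃ n < m, x ∈ lowerLimits t r n ∧ x ∉ lowerLimits t r (n + 1) :=
    fun x hx => exists_level (K := lowerLimits t r) rfl fun hx' => hOm.subset ⟨hx, hx'⟩
  choose! q hqm hq hq' using hlev
  let ι := ULift.{u} (Fin (N + 1) × Fin (m + 1))
  -- `Fin.ofNat` reduces modulo the size, which loses nothing on `O`, where `t x ≤ N` and `q x < m`.
  let l : X → ι := fun x => ⟨(Fin.ofNat _ (t x), Fin.ofNat _ (q x))⟩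
  have hl : ∀ x ∈ O, ∀ y ∈ O, l x = l y → t x = t y ∧ q x = q y := by
    intro x hx y hy h
    have h1 : t x % (N + 1) = t y % (N + 1) := congrArg (fun a : ι => a.down.1.1) h
    have h2 : q x % (m + 1) = q y % (m + 1) := congrArg (fun a : ι => a.down.2.1) h
    rw [Nat.mod_eq_of_lt (htN x (hOO₁ hx)), Nat.mod_eq_of_lt (htN y (hOO₁ hy))] at h1
    rw [Nat.mod_eq_of_lt ((hqm x hx).trans (Nat.lt_succ_self _)),
      Nat.mod_eq_of_lt ((hqm y hy).trans (Nat.lt_succ_self _))] at h2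
    exact ⟨h1, h2⟩
  have hsep : ∀ x ∈ O, ∀ B ⊆ O, #B < μ → InjOn r B → (∀ b ∈ B, l b = l x) →
      x ∉ closure (B \ {x}) := by
    intro x hx B hB hBμ hBr hBl hcl
    have htq : ∀ b ∈ B, t b = t x ∧ q b = q x := fun b hb => hl b (hB hb) x hx (hBl b hb)
    -- Split `B` by rank. At most one point has the rank of `x`; lower ranks contradict the choice
    -- of `q x`; higher ranks avoid `A x` and contradict the choice of `t x`.
    have h1 : x ∈ closure (B \ {b | r b = r x}) := by
      refine mem_closure_of_subset_union_subsingleton (T := {b ∈ B | r b = r x} \ {x}) hcl ?_ ?_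
        fun h => h.2 rfl
      · intro b hb
        by_cases h : r b = r x
        · exact Or.inr ⟨⟨hb.1, h⟩, hb.2⟩
        · exact Or.inl ⟨hb.1, h⟩
      · intro b hb b' hb'
        exact hBr hb.1.1 hb'.1.1 (hb.1.2.trans hb'.1.2.symm)
    have h2 : B \ {b | r b = r x} ⊆ {b ∈ B | r b < r x} ∪ {b ∈ B | r x < r b} := by
      intro b hb
      rcases lt_or_gt_of_ne (show r b ≠ r x from hb.2) with h | h
      · exact Or.inl ⟨hb.1, h⟩
      · exact Or.inr ⟨hb.1, h⟩
    have h3 := closure_mono h2 h1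
    rw [closure_union] at h3
    rcases h3 with h3 | h3
    · refine hq' x hx ⟨hq x hx, closure_mono ?_ h3⟩
      intro b hb
      refine ⟨?_, (htq b hb.1).1, hb.2⟩
      rw [← (htq b hb.1).2]
      exact hq b (hB hb.1)
    · refine hA x (hOO₁ hx) {b ∈ B | r x < r b} (fun b hb => ?_)
        (mk_subset_lt (fun b hb => hb.1) hBμ) (Set.disjoint_left.2 fun b hb hbA => ?_) h3
      · rw [← (htq b hb.1).1]
        exact ht b (hOO₁ (hB hb.1))
      · exact (hrA x b hbA).not_gt hb.2
  have hbot : ∀ x ∈ O, ∀ B ⊆ O, B ⊆ iterLimits μ N → #B < μ → Disjoint B (A x) →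
      x ∉ closure B := fun x hx B _ hBH => hA x (hOO₁ hx) B
    (hBH.trans (antitone_iterLimits (Nat.lt_succ_iff.1 (htN x (hOO₁ hx)))))
  have key : ∀ c : ℕ, ∀ V ⊆ O, IsOpen V → V.Nonempty → ∀ M : Set X, #M < μ →
      ∃ s : Finset ι, s.card = c ∧ ∃ y ∈ V, ∃ B,
        IsConfig μ O (iterLimits μ N) l r s M y B := by
    intro c
    induction c with
    | zero =>
      intro V hVO hV hVne M hM
      obtain ⟨y, hy, hyM⟩ : ∃ y ∈ V ∩ iterLimits μ N, y ∉ M := by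
        by_contra! hno
        exact (hH V (hVO.trans hOO₁) hV hVne).not_gt (mk_subset_lt hno hM)
      refine ⟨∅, rfl, y, hy.1, fun _ => ∅, hyM, by simp, by simp, by simp, by simp, by simp,
        fun _ => ?_, by simp, ⟨none, hy.2⟩⟩
      rw [mk_eq_zero]
      exact hμ.pos
    | succ c ih =>
      intro V hVO hV hVne M hM
      exact exists_config_succ hμ hκ hext hacc hpi hAμ hr hsep hbot ih hVO hV hVne hM
  obtain ⟨s, hs, y, -, B, -⟩ := key (Nat.card ι + 1) O subset_rfl hO hOne ∅
    (by rw [mk_eq_zero]; exact hμ.pos)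
  have := Fintype.ofFinite ι
  have := s.card_le_univ
  rw [hs, Nat.card_eq_fintype_card] at this
  omega

theorem isPiNetwork_isRegularClosed [RegularSpace X] :
    IsPiNetwork {F : Set X | IsRegularClosed F} := by
  rintro U hU ⟨x, hx⟩
  obtain ⟨C, hC, hCc, hCU⟩ := exists_mem_nhds_isClosed_subset (hU.mem_nhds hx)
  refine ⟨closure (interior C), ?_, ⟨x, subset_closure (mem_interior_iff_mem_nhds.2 hC)⟩,
    (closure_minimal interior_subset hCc).trans hCU⟩
  exact (closure_mono interior_subset |>.trans closure_closure.subset).antisymm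
    (closure_mono (interior_maximal subset_closure isOpen_interior))

/-- A point of `tPoints μ X` in a small open `V` would be a limit of a set missing `V`. -/
theorem le_mk_of_dense_tPoints {μ : Cardinal.{u}} (hd : Dense (tPoints μ X)) {V : Set X}
    (hV : IsOpen V) (hne : V.Nonempty) : μ ≤ #V := by
  by_contra hlt
  obtain ⟨x, hxV, hx⟩ := hd.inter_open_nonempty V hV hne
  obtain ⟨B, hB, -, hxB⟩ := hx V (not_le.1 hlt)
  obtain ⟨z, hzV, hzB⟩ := mem_closure_iff.1 hxB V hV hxV
  exact hB hzB hzV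

end Main

end Resolvability

theorem mainTheorem2 (X : Type u) [TopologicalSpace X] :
    (T1Space X →
      Resolvability.IsPiNetwork {F : Set X | Resolvability.IsRegularClosed F} →
      (∃ μ : Cardinal.{u}, μ.IsRegular ∧ Resolvability.extentHat X < μ ∧
        Dense (Resolvability.tPoints μ X)) →
      Resolvability.IsResolvable ℵ₀ X) ∧
    (T3Space X →
      Resolvability.extentHat X < Resolvability.dispersionCharacter X →
      Resolvability.IsResolvable ℵ₀ X) := by
  refine ⟨fun hT1 hpi ⟨μ, hμ, hext, hd⟩ => ?_, fun hT3 hlt => ?_⟩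
  · exact Resolvability.isResolvable_of_chains fun U hU hne =>
      Resolvability.exists_chain hpi hμ hext
        (fun V hV hVne => Resolvability.le_mk_of_dense_tPoints hd hV hVne) hU hne
  · have hκ := (Resolvability.exists_mem_closure_sdiff_of_extentHat (X := X)).1
    refine Resolvability.isResolvable_of_chains fun U hU hne =>
      Resolvability.exists_chain Resolvability.isPiNetwork_isRegularClosed
        (isRegular_succ hκ) (Order.lt_succ _) (fun V hV hVne => ?_) hU hne
    exact (Order.succ_le_of_lt hlt).trans (csInf_le' ⟨V, hV, hVne, rfl⟩)
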